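/- Let $W$ be a real random variable that is almost surely positive and not almost surely constant, with $\mathbb{E}(W)=1$ and $\mathbb{E}(W\log_2 W)<1$ (the subcritical regime; $W\log_2 W$ is integrable). Let $\{W_{\mathbf i}:\mathbf i\in\{0,1\}^*\}$, indexed by the finite words over $\{0,1\}$, be independent random variables with the distribution of $W$. For a word $\mathbf i=i_1\cdots i_k$ let $I_{\mathbf i}=\big[\sum_{j=1}^k 2^{-j}i_j,\ \sum_{j=1}^k 2^{-j}i_j+2^{-k}\big)$, the rightmost intervals $[1-2^{-k},1]$ being taken closed, and let $$L_{\mathbf i}=\lim_{n\to\infty}\sum_{\mathbf j\in\{0,1\}^n}2^{-n}\,W_{\mathbf i j_1}\cdots W_{\mathbf i j_1\cdots j_n},$$ a limit which exists almost surely. Let $\mu$ be the random multiplicative cascade measure, that is, the Borel measure on $[0,1]$ obtained by extension from $\mu(I_{\mathbf i})=2^{-k}W_{i_1}W_{i_1i_2}\cdots W_{i_1\cdots i_k}L_{\mathbf i}$, and let $f(x)=\mu([0,x))$ for $x\in[0,1]$ be the multiplicative cascade function. For $F\subset\mathbb{R}$ let $\dim_{\rm P}F=\inf\{t\ge 0:\mathcal{P}^t(F)=0\}$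 be its packing dimension, where $\mathcal{P}^t(F)=\inf\{\sum_n\mathcal{P}^t_0(F_n):F\subset\bigcup_{n=1}^\infty F_n\}$ is the $t$-dimensional packing measure and $\mathcal{P}^t_0(F)=\lim_{\delta\to0}\sup\sum_i(2r_i)^t$, the supremum being over countable families of disjoint closed balls with centres in $F$ and radii $0<r_i\le\delta$. Let $E\subset[0,1]$ be non-empty and compact, and let $d_E=\dim_{\rm P}E$. Then there is a unique $s\in[0,1]$ with $$2^{d_E}=\frac{2^s}{\mathbb{E}(W^s)},$$ and for this $s$, and indeed for every real $s$ with $\mathbb{E}(W^s)<\infty$ that satisfies this equation, almost surely $\dim_{\rm P}f(E)\le s$. -/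

import Mathlib

open MeasureTheory ProbabilityTheory Filter Topology Set
open scoped ENNReal NNReal

noncomputable section

namespace Cascade

/-! ### Dyadic intervals, indexed by finite words over `{0,1}` (`true` is the letter 1) -/

/-- Left endpoint `∑ⱼ 2⁻ʲ iⱼ` of the dyadic interval of the word `i = i₁ ⋯ iₖ`. -/
def leftEnd (i : List Bool) : ℝ :=
  ∑ j : Fin i.length, if i.get j then ((2 : ℝ) ^ ((j : ℕ) + 1))⁻¹ else 0

/-- The dyadic interval `I_i` of length `2⁻ᵏ`, `k = |i|`: half-open on the right, except for the
rightmost interval of each level (all letters equal to 1), which is closed. -/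
def dyadicInterval (i : List Bool) : Set ℝ :=
  if false ∈ i then Ico (leftEnd i) (leftEnd i + ((2 : ℝ) ^ i.length)⁻¹)
  else Icc (leftEnd i) (leftEnd i + ((2 : ℝ) ^ i.length)⁻¹)

/-! ### The multiplicative cascade with weights `w i`, `i ∈ {0,1}^*` -/

/-- `w_{i j₁} w_{i j₁ j₂} ⋯ w_{i j₁ ⋯ jₙ}`, where `j = j₁ ⋯ jₙ`. -/
def pathWeight (w : List Bool → ℝ) (i j : List Bool) : ℝ :=
  ∏ m ∈ Finset.range j.length, w (i ++ j.take (m + 1))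

/-- `∑_{j ∈ {0,1}ⁿ} 2⁻ⁿ w_{i j₁} ⋯ w_{i j₁ ⋯ jₙ}`. -/
def partialLength (w : List Bool → ℝ) (i : List Bool) (n : ℕ) : ℝ :=
  ∑ j : Fin n → Bool, ((2 : ℝ) ^ n)⁻¹ * pathWeight w i (List.ofFn j)

/-- `L_i`, the limit of `partialLength w i n` as `n → ∞`. -/
def limitLength (w : List Bool → ℝ) (i : List Bool) : ℝ :=
  limUnder atTop (partialLength w i)

/-- The mass `2⁻ᵏ w_{i₁} ⋯ w_{i₁ ⋯ iₖ} L_i` prescribed for the dyadic interval `I_i`. -/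
def intervalMass (w : List Bool → ℝ) (i : List Bool) : ℝ :=
  ((2 : ℝ) ^ i.length)⁻¹ * pathWeight w [] i * limitLength w i

/-- The prescribed masses as a set function: the mass of `I_i` on `I_i`, and `∞` on sets that are
not dyadic intervals. -/
def dyadicContent (w : List Bool → ℝ) (A : Set ℝ) : ℝ≥0∞ :=
  ⨅ (i : List Bool) (_ : A = dyadicInterval i), ENNReal.ofReal (intervalMass w i)

/-- The multiplicative cascade measure on `[0,1]`: the extension to Borel sets of the masses of the
dyadic intervals. By Carathéodory's construction, the measure of a Borel set `A ⊆ [0,1]` is the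
limit as `r → 0` of the infimum of the total masses of countable covers of `A` by dyadic intervals
of diameter at most `r` (the masses being additive, the infimum does not depend on `r`). -/
def cascadeMeasure (w : List Bool → ℝ) : Measure ℝ :=
  (Measure.mkMetric' (dyadicContent w)).restrict (Icc 0 1)

/-- The multiplicative cascade function `f(x) = μ([0,x))`. -/
def cascadeFun (w : List Bool → ℝ) (x : ℝ) : ℝ :=
  (cascadeMeasure w (Ico 0 x)).toReal

/-- The standing assumptions on the generator `W` of a subcritical cascade: `W` is positive, not
almost surely constant, `E(W) = 1`, and `E(W log₂ W) < 1`. -/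
structure IsSubcritical {Ω : Type*} [MeasurableSpace Ω] (P : Measure Ω) (W : Ω → ℝ) : Prop where
  pos : ∀ᵐ ω ∂P, 0 < W ω
  not_const : ¬ ∃ c : ℝ, ∀ᵐ ω ∂P, W ω = c
  integrable : Integrable W P
  mean_one : ∫ ω, W ω ∂P = 1
  integrable_mul_logb : Integrable (fun ω => W ω * Real.logb 2 (W ω)) P
  subcritical : ∫ ω, W ω * Real.logb 2 (W ω) ∂P < 1

/-! ### Packing measures and packing dimension of subsets of the line -/

/-- `T` (a set of pairs (centre, radius)) is a `δ`-packing of `F`: a countable family of disjoint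
closed balls with centres in `F` and positive radii at most `δ`. -/
structure IsPacking (δ : ℝ) (F : Set ℝ) (T : Set (ℝ × ℝ)) : Prop where
  countable : T.Countable
  center_mem : ∀ p ∈ T, p.1 ∈ F
  radius_pos : ∀ p ∈ T, 0 < p.2
  radius_le : ∀ p ∈ T, p.2 ≤ δ
  disjoint : T.PairwiseDisjoint fun p => Metric.closedBall p.1 p.2

/-- `P^s_δ(F)`: supremum of `∑ |B|^s` over the `δ`-packings of `F`. -/
def packingSup (s δ : ℝ) (F : Set ℝ) : ℝ≥0∞ :=
  ⨆ (T : Set (ℝ × ℝ)) (_ : IsPacking δ F T), ∑' p : T, ENNReal.ofReal (2 * p.1.2) ^ s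

/-- The packing premeasure `P^s_0(F) = lim_{δ → 0} P^s_δ(F)`, a decreasing limit. -/
def packingPremeasure (s : ℝ) (F : Set ℝ) : ℝ≥0∞ :=
  ⨅ (δ : ℝ) (_ : 0 < δ), packingSup s δ F

/-- The `s`-dimensional packing measure
`P^s(F) = inf {∑ₙ P^s_0(Fₙ) : F ⊆ ⋃ₙ Fₙ}`. -/
def packingMeasure (s : ℝ) (F : Set ℝ) : ℝ≥0∞ :=
  ⨅ (A : ℕ → Set ℝ) (_ : F ⊆ ⋃ n, A n), ∑' n, packingPremeasure s (A n)

/-- The packing dimension `inf {s ≥ 0 : P^s(F) = 0}`. -/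
def packingDim (F : Set ℝ) : ℝ≥0∞ :=
  ⨅ (s : ℝ≥0) (_ : packingMeasure s F = 0), (s : ℝ≥0∞)

end Cascade

end

noncomputable section

namespace Cascade

/-! ### Dyadic intervals -/

/-! Write `halfMoment` as g(s) = E((W/2)^s), so that the equation for s reads g(s) = 2^(-d_E). The
proof is a first-moment estimate combined with a stopping-time cover of the image.

Let F ⊆ [0,1] have finite u-dimensional packing premeasure. Then at most C·2^(nu) dyadic intervals
of each large level n meet F (`encard_hitWords_succ_le`). By independence the s-th moment of the
mass of a level-n interval is at most 2·g(s)^n (`lintegral_liminfMass_rpow_le`). If 2^u g(s) < 1,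
the sum of mass^s over all intervals meeting F therefore has finite expectation and is almost surely
finite.

This sum controls packings of f(F) (`packingPremeasure_image_lt_top`). A ball centred at f(x) of
radius r is assigned the largest dyadic interval at x of mass at most r. Since f oscillates over an
interval by at most its mass, disjoint balls receive distinct intervals. Unless that interval is the
root, its parent has mass above r and pays for r^s.

If g(s') < 2^(-d_E), then E is covered by countably many sets F of this kind with 2^u g(s') < 1, so
f(E) has packing dimension at most s'. As g is strictly decreasing on [0,1]
(`strictAntiOn_halfMoment`), every s' in (s,1] qualifies, and s' decreases to s. Solutions s ≥ 1
need no argument, as the line has dimension at most 1, and negative solutions do not exist. -/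

theorem leftEnd_append_singleton (v : List Bool) (b : Bool) :
    leftEnd (v ++ [b]) = leftEnd v + if b then ((2 : ℝ) ^ (v.length + 1))⁻¹ else 0 := by
  have key : ∀ i : List Bool, leftEnd i = ∑ m ∈ Finset.range i.length,
      if i.getD m false then ((2 : ℝ) ^ (m + 1))⁻¹ else 0 := by
    intro i
    rw [Finset.sum_range]
    simp [leftEnd]
  rw [key, key, List.length_append, List.length_singleton, Finset.sum_range_succ]
  congr 1
  · refine Finset.sum_congr rfl fun m hm => ?_
    rw [List.getD_append _ _ _ _ (Finset.mem_range.1 hm)]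
  · simp

theorem dyadicInterval_eq_union (v : List Bool) :
    dyadicInterval v = dyadicInterval (v ++ [false]) ∪ dyadicInterval (v ++ [true]) := by
  have h : (0 : ℝ) < ((2 : ℝ) ^ (v.length + 1))⁻¹ := by positivity
  have h2 : ((2 : ℝ) ^ v.length)⁻¹
      = ((2 : ℝ) ^ (v.length + 1))⁻¹ + ((2 : ℝ) ^ (v.length + 1))⁻¹ := by
    rw [pow_succ]; field_simp; norm_num
  by_cases hv : false ∈ v
  · simp only [dyadicInterval, leftEnd_append_singleton, List.mem_append, hv, true_or, if_true,
      List.length_append, List.length_singleton, Bool.false_eq_true, if_false, add_zero, h2]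
    rw [Ico_union_Ico_eq_Ico (by linarith) (by linarith), add_assoc]
  · simp only [dyadicInterval, leftEnd_append_singleton, List.mem_append, hv, false_or, if_true,
      List.length_append, List.length_singleton, Bool.false_eq_true, if_false, add_zero, h2,
      List.mem_singleton]
    rw [Ico_union_Icc_eq_Icc (by linarith) (by linarith), add_assoc]

theorem dyadicInterval_append_subset (v : List Bool) (b : Bool) :
    dyadicInterval (v ++ [b]) ⊆ dyadicInterval v := by
  rw [dyadicInterval_eq_union v]
  cases b
  · exact subset_union_left
  · exact subset_union_right

theorem dyadicInterval_nil : dyadicInterval [] = Icc 0 1 := by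
  simp [dyadicInterval, leftEnd]

theorem dyadicInterval_subset_Icc (i : List Bool) :
    dyadicInterval i ⊆ Icc (leftEnd i) (leftEnd i + ((2 : ℝ) ^ i.length)⁻¹) := by
  unfold dyadicInterval
  split_ifs
  · exact Ico_subset_Icc_self
  · exact subset_rfl

theorem dyadicInterval_subset_unit (i : List Bool) : dyadicInterval i ⊆ Icc 0 1 := by
  induction i using List.reverseRecOn with
  | nil => rw [dyadicInterval_nil]
  | append_singleton v b ih => exact (dyadicInterval_append_subset v b).trans ih

theorem measurableSet_dyadicInterval (i : List Bool) : MeasurableSet (dyadicInterval i) := by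
  unfold dyadicInterval
  split_ifs
  · exact measurableSet_Ico
  · exact measurableSet_Icc

theorem ordConnected_dyadicInterval (i : List Bool) : (dyadicInterval i).OrdConnected := by
  unfold dyadicInterval
  split_ifs
  · exact ordConnected_Ico
  · exact ordConnected_Icc

theorem ediam_dyadicInterval_le (i : List Bool) :
    Metric.ediam (dyadicInterval i) ≤ ENNReal.ofReal ((2 : ℝ) ^ i.length)⁻¹ := by
  refine (Metric.ediam_mono (dyadicInterval_subset_Icc i)).trans ?_
  rw [Real.ediam_Icc, add_sub_cancel_left]

/-- The left endpoints of distinct words of length `n` are at distance at least `2⁻ⁿ`. -/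
theorem le_abs_leftEnd_sub {n : ℕ} : ∀ {v w : List Bool}, v.length = n → w.length = n → v ≠ w →
    ((2 : ℝ) ^ n)⁻¹ ≤ |leftEnd v - leftEnd w| := by
  induction n with
  | zero =>
    intro v w hv hw hne
    rw [List.length_eq_zero_iff] at hv hw
    exact absurd (hv.trans hw.symm) hne
  | succ n ih =>
    intro v w hv hw hne
    induction v using List.reverseRecOn with
    | nil => simp at hv
    | append_singleton v b _ =>
      induction w using List.reverseRecOn with
      | nil => simp at hw
      | append_singleton w c _ =>
        have hv' : v.length = n := by simpa using hv
        have hw' : w.length = n := by simpa using hw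
        have h : (0 : ℝ) < ((2 : ℝ) ^ (n + 1))⁻¹ := by positivity
        have h2 : ((2 : ℝ) ^ n)⁻¹ = 2 * ((2 : ℝ) ^ (n + 1))⁻¹ := by
          rw [pow_succ]; field_simp
        rw [leftEnd_append_singleton, leftEnd_append_singleton, hv', hw']
        by_cases hvw : v = w
        · subst hvw
          have hbc : b ≠ c := fun hbc => hne (by rw [hbc])
          cases b <;> cases c <;> simp at hbc ⊢
        -- The prefixes are already 2·2⁻⁽ⁿ⁺¹⁾ apart, and the last letters change the difference by
        -- at most 2⁻⁽ⁿ⁺¹⁾.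
        · have := ih hv' hw' hvw
          rw [h2] at this
          generalize leftEnd v = x at *
          generalize leftEnd w = y at *
          rcases le_abs.1 this with h3 | h3 <;>
            (cases b <;> cases c <;> simp only [if_true, Bool.false_eq_true, if_false] <;>
              first
              | (refine le_trans ?_ (le_abs_self _); linarith)
              | (refine le_trans ?_ (neg_le_abs _); linarith))

/-! ### Masses of dyadic intervals -/

theorem pathWeight_append_singleton (w : List Bool → ℝ) (i j : List Bool) (b : Bool) :
    pathWeight w i (j ++ [b]) = pathWeight w i j * w (i ++ j ++ [b]) := by
  rw [pathWeight, List.length_append, List.length_singleton, Finset.prod_range_succ]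
  congr 1
  · refine Finset.prod_congr rfl fun m hm => ?_
    rw [List.take_append_of_le_length (by have := Finset.mem_range.1 hm; omega)]
  · rw [List.take_of_length_le (by simp), List.append_assoc]

theorem pathWeight_cons (w : List Bool → ℝ) (i j : List Bool) (b : Bool) :
    pathWeight w i (b :: j) = w (i ++ [b]) * pathWeight w (i ++ [b]) j := by
  rw [pathWeight, List.length_cons, Finset.prod_range_succ', mul_comm]
  simp [pathWeight]

theorem pathWeight_nonneg {w : List Bool → ℝ} (hw : ∀ i, 0 ≤ w i) (i j : List Bool) :
    0 ≤ pathWeight w i j :=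
  Finset.prod_nonneg fun _ _ => hw _

theorem partialLength_nonneg {w : List Bool → ℝ} (hw : ∀ i, 0 ≤ w i) (i : List Bool) (n : ℕ) :
    0 ≤ partialLength w i n :=
  Finset.sum_nonneg fun _ _ => mul_nonneg (by positivity) (pathWeight_nonneg hw _ _)

theorem partialLength_succ (w : List Bool → ℝ) (i : List Bool) (n : ℕ) :
    partialLength w i (n + 1) = 2⁻¹ * (w (i ++ [false]) * partialLength w (i ++ [false]) n
      + w (i ++ [true]) * partialLength w (i ++ [true]) n) := by
  rw [partialLength, ← (Fin.consEquiv fun _ : Fin (n + 1) => Bool).sum_comp,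
    Fintype.sum_prod_type, Fintype.sum_bool, add_comm]
  simp only [partialLength, mul_add, Finset.mul_sum]
  congr 1 <;>
  · refine Finset.sum_congr rfl fun j _ => ?_
    simp only [Fin.consEquiv, Equiv.coe_fn_mk, List.ofFn_cons, pathWeight_cons]
    rw [pow_succ]
    ring

theorem partialLength_succ_snoc (w : List Bool → ℝ) (i : List Bool) (n : ℕ) :
    partialLength w i (n + 1) = ∑ j : Fin n → Bool,
      (((2 : ℝ) ^ n)⁻¹ * pathWeight w i (List.ofFn j)) *
        (2⁻¹ * (w (i ++ List.ofFn j ++ [false]) + w (i ++ List.ofFn j ++ [true]))) := by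
  rw [partialLength, ← (Fin.snocEquiv fun _ : Fin (n + 1) => Bool).sum_comp,
    Fintype.sum_prod_type, Fintype.sum_bool, add_comm, ← Finset.sum_add_distrib]
  refine Finset.sum_congr rfl fun j _ => ?_
  have h : ∀ b, List.ofFn (Fin.snoc (α := fun _ => Bool) j b) = List.ofFn j ++ [b] := by
    intro b
    rw [List.ofFn_succ', List.concat_eq_append]
    simp
  simp only [Fin.snocEquiv, Equiv.coe_fn_mk, h, pathWeight_append_singleton]
  rw [pow_succ]
  ring

/-- All the limits `L_i` exist. -/
def HasLimits (w : List Bool → ℝ) : Prop :=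
  ∀ i, ∃ l, Tendsto (partialLength w i) atTop (𝓝 l)

section

variable {w : List Bool → ℝ} (hw : ∀ i, 0 ≤ w i) (hlim : HasLimits w)
include hlim

theorem tendsto_limitLength (i : List Bool) :
    Tendsto (partialLength w i) atTop (𝓝 (limitLength w i)) :=
  tendsto_nhds_limUnder (hlim i)

theorem limitLength_eq (i : List Bool) :
    limitLength w i = 2⁻¹ * (w (i ++ [false]) * limitLength w (i ++ [false])
      + w (i ++ [true]) * limitLength w (i ++ [true])) := by
  refine tendsto_nhds_unique ((tendsto_add_atTop_iff_nat 1).2 (tendsto_limitLength hlim i)) ?_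
  simp only [partialLength_succ]
  exact (((tendsto_limitLength hlim _).const_mul _).add
    ((tendsto_limitLength hlim _).const_mul _)).const_mul _

theorem intervalMass_eq_add (i : List Bool) :
    intervalMass w i = intervalMass w (i ++ [false]) + intervalMass w (i ++ [true]) := by
  simp only [intervalMass, pathWeight_append_singleton, List.length_append, List.length_singleton,
    List.nil_append]
  rw [limitLength_eq hlim i, pow_succ]
  ring

include hw

theorem limitLength_nonneg (i : List Bool) : 0 ≤ limitLength w i :=
  ge_of_tendsto' (tendsto_limitLength hlim i) (partialLength_nonneg hw i)

theorem intervalMass_nonneg (i : List Bool) : 0 ≤ intervalMass w i :=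
  mul_nonneg (mul_nonneg (by positivity) (pathWeight_nonneg hw _ _)) (limitLength_nonneg hw hlim i)

/-- Subdividing often enough brings the diameters below r, and additivity of the masses keeps their
total equal to that of the original interval. Only this upper bound on the measure is needed. -/
theorem cascadeMeasure_dyadicInterval_le (i : List Bool) :
    cascadeMeasure w (dyadicInterval i) ≤ ENNReal.ofReal (intervalMass w i) := by
  refine (Measure.restrict_apply_le _ _).trans ?_
  rw [Measure.mkMetric', toMeasure_apply _ _ (measurableSet_dyadicInterval i),
    OuterMeasure.mkMetric']
  simp only [OuterMeasure.iSup_apply]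
  refine iSup₂_le fun r hr => ?_
  have key : ∀ n : ℕ, ∀ i : List Bool, ENNReal.ofReal ((2 : ℝ) ^ (i.length + n))⁻¹ ≤ r →
      OuterMeasure.mkMetric'.pre (dyadicContent w) r (dyadicInterval i)
        ≤ ENNReal.ofReal (intervalMass w i) := by
    intro n
    induction n with
    | zero =>
      intro i hi
      refine (OuterMeasure.mkMetric'.pre_le (m := dyadicContent w)
        ((ediam_dyadicInterval_le i).trans hi)).trans ?_
      exact iInf₂_le (f := fun j (_ : dyadicInterval i = dyadicInterval j) =>
        ENNReal.ofReal (intervalMass w j)) i rfl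
    | succ n ih =>
      intro i hi
      rw [intervalMass_eq_add hlim i, ENNReal.ofReal_add (intervalMass_nonneg hw hlim _)
        (intervalMass_nonneg hw hlim _), dyadicInterval_eq_union i]
      have h : ∀ b, ENNReal.ofReal ((2 : ℝ) ^ ((i ++ [b]).length + n))⁻¹ ≤ r := by
        intro b
        rw [List.length_append, List.length_singleton, add_assoc, add_comm 1 n]
        exact hi
      exact (measure_union_le _ _).trans (add_le_add (ih _ (h _)) (ih _ (h _)))
  have ht : Tendsto (fun n : ℕ => ENNReal.ofReal ((2 : ℝ) ^ (i.length + n))⁻¹) atTop (𝓝 0) := by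
    rw [← ENNReal.ofReal_zero]
    refine ENNReal.tendsto_ofReal ?_
    have := (tendsto_pow_atTop_nhds_zero_of_lt_one (r := (2 : ℝ)⁻¹) (by norm_num)
      (by norm_num)).comp (tendsto_add_atTop_nat i.length)
    refine this.congr fun n => ?_
    simp [add_comm]
  obtain ⟨n, hn⟩ := (ht.eventually_lt_const hr).exists
  exact key n i hn.le

theorem abs_cascadeFun_sub_le {i : List Bool} {x y : ℝ} (hx : x ∈ dyadicInterval i)
    (hy : y ∈ dyadicInterval i) :
    |cascadeFun w x - cascadeFun w y| ≤ intervalMass w i := by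
  wlog hxy : y ≤ x generalizing x y
  · rw [abs_sub_comm]
    exact this hy hx (le_of_not_ge hxy)
  have h1 : Icc y x ⊆ dyadicInterval i := (ordConnected_dyadicInterval i).out hy hx
  -- `toReal` sends ∞ to 0, so monotonicity of `cascadeFun` needs finiteness, which comes from the
  -- mass of the root.
  have hfin : ∀ z ∈ Icc (0 : ℝ) 1, cascadeMeasure w (Ico 0 z) ≠ ∞ := by
    intro z hz
    refine ne_top_of_le_ne_top ?_ ((measure_mono (t := dyadicInterval []) ?_).trans
      (cascadeMeasure_dyadicInterval_le hw hlim []))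
    · exact ENNReal.ofReal_ne_top
    · rw [dyadicInterval_nil]
      exact Ico_subset_Icc_self.trans (Icc_subset_Icc_right hz.2)
  have hy0 := dyadicInterval_subset_unit i hy
  have hx0 := dyadicInterval_subset_unit i hx
  have hle : cascadeMeasure w (Ico 0 x) ≤ cascadeMeasure w (Ico 0 y)
      + ENNReal.ofReal (intervalMass w i) := by
    rw [← Ico_union_Ico_eq_Ico hy0.1 hxy]
    refine (measure_union_le _ _).trans (add_le_add le_rfl ?_)
    exact (measure_mono (Ico_subset_Icc_self.trans h1)).trans
      (cascadeMeasure_dyadicInterval_le hw hlim i)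
  have hmono : cascadeFun w y ≤ cascadeFun w x :=
    ENNReal.toReal_mono (hfin x hx0) (measure_mono (Ico_subset_Ico_right hxy))
  rw [abs_of_nonneg (sub_nonneg.2 hmono), sub_le_iff_le_add', cascadeFun, cascadeFun]
  refine (ENNReal.toReal_mono (by finiteness [hfin y hy0]) hle).trans ?_
  rw [ENNReal.toReal_add (hfin y hy0) ENNReal.ofReal_ne_top,
    ENNReal.toReal_ofReal (intervalMass_nonneg hw hlim i)]

end

/-! ### Packing measures and dimension -/

theorem IsPacking.mono {δ δ' : ℝ} {F F' : Set ℝ} {T : Set (ℝ × ℝ)} (h : IsPacking δ F T)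
    (hδ : δ ≤ δ') (hF : F ⊆ F') : IsPacking δ' F' T :=
  ⟨h.countable, fun p hp => hF (h.center_mem p hp), h.radius_pos,
    fun p hp => (h.radius_le p hp).trans hδ, h.disjoint⟩

theorem packingSup_mono (s : ℝ) {δ δ' : ℝ} {F F' : Set ℝ} (hδ : δ ≤ δ') (hF : F ⊆ F') :
    packingSup s δ F ≤ packingSup s δ' F' :=
  iSup₂_le fun T hT => le_iSup₂_of_le T (hT.mono hδ hF) le_rfl

theorem packingPremeasure_mono (s : ℝ) {F F' : Set ℝ} (hF : F ⊆ F') :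
    packingPremeasure s F ≤ packingPremeasure s F' :=
  iInf₂_mono fun _ _ => packingSup_mono s le_rfl hF

theorem exists_packingSup_lt_top {s : ℝ} {F : Set ℝ} (h : packingPremeasure s F < ∞) :
    ∃ δ > 0, packingSup s δ F < ∞ := by
  simpa only [packingPremeasure, iInf_lt_iff, exists_prop] using h

/-- Raising the exponent from s to t costs each ball a factor of at most (2δ)^(t-s), which tends to
0 with δ. -/
theorem packingPremeasure_eq_zero_of_lt {s t : ℝ} (hst : s < t) {F : Set ℝ}
    (h : packingPremeasure s F < ∞) : packingPremeasure t F = 0 := by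
  obtain ⟨δ₀, hδ₀, hlt⟩ := exists_packingSup_lt_top h
  have key : ∀ δ : ℝ, 0 < δ → δ ≤ δ₀ →
      packingPremeasure t F ≤ ENNReal.ofReal (2 * δ) ^ (t - s) * packingSup s δ₀ F := by
    intro δ hδ hle
    refine (iInf₂_le δ hδ).trans (iSup₂_le fun T hT => ?_)
    calc ∑' p : T, ENNReal.ofReal (2 * p.1.2) ^ t
        ≤ ∑' p : T, ENNReal.ofReal (2 * δ) ^ (t - s) * ENNReal.ofReal (2 * p.1.2) ^ s := by
          refine ENNReal.tsum_le_tsum fun p => ?_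
          have hp := hT.radius_pos p p.2
          have hp' := hT.radius_le p p.2
          have h0 : ENNReal.ofReal (2 * p.1.2) ≠ 0 := by
            rw [Ne, ENNReal.ofReal_eq_zero]; linarith
          calc ENNReal.ofReal (2 * p.1.2) ^ t
              = ENNReal.ofReal (2 * p.1.2) ^ (t - s) * ENNReal.ofReal (2 * p.1.2) ^ s := by
                rw [← ENNReal.rpow_add _ _ h0 ENNReal.ofReal_ne_top, sub_add_cancel]
            _ ≤ _ := by
                gcongr
      _ = ENNReal.ofReal (2 * δ) ^ (t - s) * ∑' p : T, ENNReal.ofReal (2 * p.1.2) ^ s :=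
          ENNReal.tsum_mul_left
      _ ≤ _ := by
          gcongr
          exact le_iSup₂_of_le T (hT.mono hle subset_rfl) le_rfl
  have ht : Tendsto (fun δ : ℝ => ENNReal.ofReal (2 * δ) ^ (t - s) * packingSup s δ₀ F)
      (𝓝[>] 0) (𝓝 0) := by
    have h1 : Tendsto (fun δ : ℝ => ENNReal.ofReal (2 * δ)) (𝓝[>] 0) (𝓝 0) := by
      have : Tendsto (fun δ : ℝ => ENNReal.ofReal (2 * δ)) (𝓝 0) (𝓝 (ENNReal.ofReal (2 * 0))) :=
        (ENNReal.continuous_ofReal.comp (continuous_const.mul continuous_id)).tendsto 0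
      rw [mul_zero, ENNReal.ofReal_zero] at this
      exact this.mono_left nhdsWithin_le_nhds
    have h2 := h1.ennrpow_const (t - s)
    rw [ENNReal.zero_rpow_of_pos (sub_pos.2 hst)] at h2
    simpa using ENNReal.Tendsto.mul_const h2 (Or.inr hlt.ne)
  refine le_antisymm (ge_of_tendsto ht ?_) zero_le
  filter_upwards [Ioc_mem_nhdsGT hδ₀] with δ hδ
  exact key δ hδ.1 hδ.2

/-- For every u > s the u-premeasures of the pieces vanish, so no summability over the pieces is
required. -/
theorem packingDim_le_of_cover {s : ℝ} (hs : 0 ≤ s) {F : Set ℝ} (A : ℕ → Set ℝ)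
    (hA : F ⊆ ⋃ n, A n) (hfin : ∀ n, packingPremeasure s (A n) < ∞) :
    packingDim F ≤ ENNReal.ofReal s := by
  lift s to ℝ≥0 using hs
  rw [ENNReal.ofReal_coe_nnreal]
  refine le_of_forall_gt fun t ht => ?_
  obtain ⟨u, hsu, hut⟩ := ENNReal.lt_iff_exists_nnreal_btwn.1 ht
  refine lt_of_le_of_lt (iInf₂_le u ?_) hut
  refine le_antisymm ((iInf₂_le A hA).trans_eq ?_) zero_le
  rw [ENNReal.tsum_eq_zero]
  exact fun n => packingPremeasure_eq_zero_of_lt (by exact_mod_cast hsu) (hfin n)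

theorem exists_cover_of_packingDim_lt {t : ℝ≥0} {F : Set ℝ} (h : packingDim F < t) :
    ∃ u : ℝ≥0, u < t ∧ ∃ A : ℕ → Set ℝ, (F ⊆ ⋃ n, A n) ∧
      ∀ n, packingPremeasure u (A n) < ∞ := by
  simp only [packingDim, iInf_lt_iff] at h
  obtain ⟨u, hu, hut⟩ := h
  refine ⟨u, by exact_mod_cast hut, ?_⟩
  have h1 : packingMeasure u F < 1 := by rw [hu]; exact one_pos
  simp only [packingMeasure, iInf_lt_iff] at h1
  obtain ⟨A, hA, hlt⟩ := h1
  exact ⟨A, hA, fun n => (ENNReal.le_tsum n).trans_lt (hlt.trans ENNReal.one_lt_top)⟩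

/-- Disjoint balls of radius at most 1 centred in [a,b] are disjoint subintervals of [a-1,b+1], so
their lengths sum to at most the length of that interval. -/
theorem packingPremeasure_one_lt_top {a b : ℝ} {F : Set ℝ} (hF : F ⊆ Icc a b) :
    packingPremeasure 1 F < ∞ := by
  refine lt_of_le_of_lt (b := volume (Icc (a - 1) (b + 1))) ?_ (by simp)
  refine (iInf₂_le 1 one_pos).trans (iSup₂_le fun T hT => ?_)
  have := hT.countable.to_subtype
  calc ∑' p : T, ENNReal.ofReal (2 * p.1.2) ^ (1 : ℝ)
      = ∑' p : T, volume (Metric.closedBall p.1.1 p.1.2) := by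
        simp only [ENNReal.rpow_one, Real.volume_closedBall]
    _ = volume (⋃ p : T, Metric.closedBall p.1.1 p.1.2) := by
        refine (measure_iUnion ?_ fun p => Metric.isClosed_closedBall.measurableSet).symm
        intro p q hpq
        exact hT.disjoint p.2 q.2 (fun h => hpq (Subtype.ext h))
    _ ≤ _ := by
        refine measure_mono (iUnion_subset fun p => ?_)
        have h1 := hF (hT.center_mem p p.2)
        have h2 := hT.radius_le p p.2
        rw [Real.closedBall_eq_Icc]
        exact Icc_subset_Icc (by linarith [h1.1]) (by linarith [h1.2])

theorem packingDim_le_one (F : Set ℝ) : packingDim F ≤ 1 := by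
  rw [← ENNReal.ofReal_one]
  refine packingDim_le_of_cover zero_le_one (fun n : ℕ => F ∩ Icc (-(n : ℝ)) n) (fun x hx => ?_)
    fun n => packingPremeasure_one_lt_top inter_subset_right
  obtain ⟨n, hn⟩ := exists_nat_ge |x|
  exact mem_iUnion.2 ⟨n, hx, abs_le.1 hn⟩

/-! ### Counting dyadic intervals that meet a set -/

/-- The words whose dyadic interval meets `F`. -/
def hitWords (F : Set ℝ) : Set (List Bool) := {i | (dyadicInterval i ∩ F).Nonempty}

/-- Fixing the last letter b separates the intervals: the parents' left endpoints are 2h apart and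
each child has length h, so points chosen in different children are at least h apart. Closed balls
of radius h/4 around them are then disjoint and form a packing. -/
theorem encard_hitWords_le {F : Set ℝ} (u : ℝ) {δ : ℝ} (n : ℕ)
    (hn : ((2 : ℝ) ^ (n + 1))⁻¹ / 4 ≤ δ) (b : Bool) :
    ((fun v => v ++ [b]) ⁻¹' hitWords F ∩ {v | v.length = n}).encard
      * ENNReal.ofReal (2 * (((2 : ℝ) ^ (n + 1))⁻¹ / 4)) ^ u ≤ packingSup u δ F := by
  set h : ℝ := ((2 : ℝ) ^ (n + 1))⁻¹ with hh
  have hpos : 0 < h := by positivity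
  have h2 : ((2 : ℝ) ^ n)⁻¹ = 2 * h := by rw [hh, pow_succ]; field_simp
  set V : Set (List Bool) := (fun v => v ++ [b]) ⁻¹' hitWords F ∩ {v | v.length = n}
  -- The value 0 outside V only makes the choice function total.
  have hx : ∀ v : List Bool, ∃ x, v ∈ V → x ∈ dyadicInterval (v ++ [b]) ∩ F := by
    intro v
    by_cases hv : v ∈ V
    · obtain ⟨x, hx⟩ := hv.1
      exact ⟨x, fun _ => hx⟩
    · exact ⟨0, fun h => absurd h hv⟩
  choose x hx using hx
  have hsep : ∀ v ∈ V, ∀ w ∈ V, v ≠ w → h ≤ |x v - x w| := by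
    intro v hv w hw hne
    have h1 := le_abs_leftEnd_sub hv.2 hw.2 hne
    have hxv := dyadicInterval_subset_Icc _ (hx v hv).1
    have hxw := dyadicInterval_subset_Icc _ (hx w hw).1
    simp only [leftEnd_append_singleton, List.length_append, List.length_singleton,
      show v.length = n from hv.2, show w.length = n from hw.2, ← hh] at hxv hxw
    rw [h2] at h1
    generalize (if b = true then h else 0) = c at *
    rcases le_abs.1 h1 with h3 | h3
    · exact le_trans (by linarith [hxv.1, hxw.2]) (le_abs_self _)
    · exact le_trans (by linarith [hxv.2, hxw.1]) (neg_le_abs _)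
  set φ : List Bool → ℝ × ℝ := fun v => (x v, h / 4)
  have hinj : InjOn φ V := by
    intro v hv w hw hvw
    by_contra hne
    have := hsep v hv w hw hne
    rw [show x v = x w from congrArg Prod.fst hvw, sub_self, abs_zero] at this
    linarith
  have hT : IsPacking δ F (φ '' V) := by
    refine ⟨(to_countable V).image _, ?_, ?_, ?_, ?_⟩
    · rintro _ ⟨v, hv, rfl⟩
      exact (hx v hv).2
    · rintro _ ⟨v, hv, rfl⟩
      exact div_pos hpos (by norm_num)
    · rintro _ ⟨v, hv, rfl⟩
      exact hn
    · rintro _ ⟨v, hv, rfl⟩ _ ⟨w, hw, rfl⟩ hne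
      refine Metric.closedBall_disjoint_closedBall ?_
      have := hsep v hv w hw (fun e => hne (by rw [e]))
      rw [Real.dist_eq]
      change h / 4 + h / 4 < |x v - x w|
      linarith
  refine le_trans (le_of_eq ?_) (le_iSup₂_of_le (φ '' V) hT le_rfl)
  rw [← hinj.encard_image, ← ENNReal.tsum_set_const]
  refine tsum_congr fun p => ?_
  obtain ⟨v, -, hp⟩ := p.2
  rw [← hp]

/-- The factor 2 comes from the two possible last letters. -/
theorem encard_hitWords_succ_le {F : Set ℝ} {u : ℝ} {δ : ℝ} (n : ℕ)
    (hn : ((2 : ℝ) ^ (n + 1))⁻¹ / 4 ≤ δ) :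
    ((hitWords F ∩ {v | v.length = n + 1}).encard : ℝ≥0∞)
      ≤ 2 * packingSup u δ F * ENNReal.ofReal (2 * (((2 : ℝ) ^ (n + 1))⁻¹ / 4)) ^ (-u) := by
  set c := ENNReal.ofReal (2 * (((2 : ℝ) ^ (n + 1))⁻¹ / 4)) with hc
  have hc0 : c ≠ 0 := by
    rw [hc, Ne, ENNReal.ofReal_eq_zero, not_le]; positivity
  have hsub : hitWords F ∩ {v | v.length = n + 1} ⊆
      (fun v => v ++ [false]) '' ((fun v => v ++ [false]) ⁻¹' hitWords F ∩ {v | v.length = n}) ∪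
      (fun v => v ++ [true]) '' ((fun v => v ++ [true]) ⁻¹' hitWords F ∩ {v | v.length = n}) := by
    rintro w ⟨hw, hl⟩
    induction w using List.reverseRecOn with
    | nil => simp at hl
    | append_singleton v b _ =>
      have hl' : v.length = n := by simpa using hl
      cases b
      · exact Or.inl ⟨v, ⟨hw, hl'⟩, rfl⟩
      · exact Or.inr ⟨v, ⟨hw, hl'⟩, rfl⟩
  have hle : ∀ b : Bool, (((fun v => v ++ [b]) ''
      ((fun v => v ++ [b]) ⁻¹' hitWords F ∩ {v | v.length = n})).encard : ℝ≥0∞)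
        ≤ packingSup u δ F * c ^ (-u) := by
    intro b
    have h1 := encard_hitWords_le (F := F) u n hn b
    rw [← hc] at h1
    rw [ENNReal.rpow_neg, ← div_eq_mul_inv, ENNReal.le_div_iff_mul_le
      (Or.inl (ENNReal.rpow_pos (pos_iff_ne_zero.2 hc0) ENNReal.ofReal_ne_top).ne')
      (Or.inl (ENNReal.rpow_ne_top_of_ne_zero hc0 ENNReal.ofReal_ne_top))]
    refine le_trans ?_ h1
    refine mul_le_mul_left ?_ _
    exact_mod_cast encard_image_le _ _
  calc ((hitWords F ∩ {v | v.length = n + 1}).encard : ℝ≥0∞)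
      ≤ (((fun v => v ++ [false]) ''
          ((fun v => v ++ [false]) ⁻¹' hitWords F ∩ {v | v.length = n})).encard +
        ((fun v => v ++ [true]) ''
          ((fun v => v ++ [true]) ⁻¹' hitWords F ∩ {v | v.length = n})).encard : ℕ∞) := by
        exact_mod_cast (encard_le_encard hsub).trans (encard_union_le _ _)
    _ ≤ packingSup u δ F * c ^ (-u) + packingSup u δ F * c ^ (-u) := by
        rw [ENat.toENNReal_add]
        exact add_le_add (hle false) (hle true)
    _ = _ := by rw [← two_mul, mul_assoc]

/-- If `F` has finite `u`-dimensional packing premeasure and `2ᵘ γ < 1`, then the sum of `γ^|i|`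
over the words `i` whose interval meets `F` is finite. -/
theorem tsum_hitWords_lt_top {F : Set ℝ} {u : ℝ} (hF : packingPremeasure u F < ∞) {γ : ℝ≥0∞}
    (hγ : (2 : ℝ≥0∞) ^ u * γ < 1) :
    ∑' i : hitWords F, γ ^ i.1.length < ∞ := by
  obtain ⟨δ, hδ, hlt⟩ := exists_packingSup_lt_top hF
  have hγtop : γ ≠ ∞ := by
    rintro rfl
    rw [ENNReal.mul_top] at hγ
    · exact absurd hγ (by simp)
    · exact (ENNReal.rpow_pos (by norm_num) (by norm_num)).ne'
  obtain ⟨n₀, hn₀⟩ : ∃ n₀ : ℕ, ∀ n ≥ n₀, ((2 : ℝ) ^ (n + 1))⁻¹ / 4 ≤ δ := by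
    have h1 : Tendsto (fun n : ℕ => ((2 : ℝ)⁻¹) ^ n) atTop (𝓝 0) :=
      tendsto_pow_atTop_nhds_zero_of_lt_one (by norm_num) (by norm_num)
    obtain ⟨n₀, h2⟩ := eventually_atTop.1 (h1.eventually_lt_const hδ)
    refine ⟨n₀, fun n hn => le_trans ?_ (h2 n hn).le⟩
    rw [← inv_pow, pow_succ]
    have : (0 : ℝ) < (2⁻¹) ^ n := by positivity
    linarith
  set H : ℕ → Set (List Bool) := fun n => hitWords F ∩ {v | v.length = n} with hH
  have hHfin : ∀ n, ((H n).encard : ℝ≥0∞) ≠ ∞ := by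
    intro n
    have : (H n).Finite := (List.finite_length_eq Bool n).subset inter_subset_right
    simpa using this
  have hunion : hitWords F ⊆ ⋃ n, H n := fun v hv => mem_iUnion.2 ⟨v.length, hv, rfl⟩
  have h1 : ∑' i : hitWords F, γ ^ i.1.length ≤ ∑' n, ((H n).encard : ℝ≥0∞) * γ ^ n := by
    refine (ENNReal.tsum_mono_subtype (fun i : List Bool => γ ^ i.length) hunion).trans ?_
    refine (ENNReal.tsum_iUnion_le_tsum (fun i : List Bool => γ ^ i.length) H).trans
      (ENNReal.tsum_le_tsum fun n => ?_)
    rw [← ENNReal.tsum_set_const]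
    exact ENNReal.tsum_le_tsum fun i => by rw [show i.1.length = n from i.2.2]
  refine h1.trans_lt ?_
  -- The counting bound at level n + 1 holds once n ≥ n₀; each of the n₀ + 1 levels before that
  -- contributes a finite amount.
  rw [← (ENNReal.summable).sum_add_tsum_nat_add' (k := n₀ + 1)]
  refine ENNReal.add_lt_top.2 ⟨ENNReal.sum_lt_top.2 fun n _ => ?_, ?_⟩
  · exact ENNReal.mul_lt_top (hHfin n).lt_top (ENNReal.pow_lt_top hγtop.lt_top)
  set K : ℝ≥0∞ := 2 * packingSup u δ F * (2 : ℝ≥0∞) ^ u with hK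
  have hKtop : K < ∞ := by
    refine ENNReal.mul_lt_top (ENNReal.mul_lt_top (by norm_num) hlt) ?_
    exact (ENNReal.rpow_ne_top_of_ne_zero (by norm_num) (by norm_num)).lt_top
  have hle : ∀ n : ℕ, ((H (n + (n₀ + 1))).encard : ℝ≥0∞) * γ ^ (n + (n₀ + 1))
      ≤ K * ((2 : ℝ≥0∞) ^ u * γ) ^ n := by
    intro n
    have h2 := encard_hitWords_succ_le (F := F) (u := u) (n + n₀) (hn₀ (n + n₀) (by omega))
    have h3 : ENNReal.ofReal (2 * (((2 : ℝ) ^ (n + n₀ + 1))⁻¹ / 4)) ^ (-u)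
        = (2 : ℝ≥0∞) ^ u * ((2 : ℝ≥0∞) ^ u) ^ (n + n₀ + 1) := by
      have h4 : 2 * (((2 : ℝ) ^ (n + n₀ + 1))⁻¹ / 4) = (2 ^ (n + n₀ + 1 + 1))⁻¹ := by
        rw [pow_succ _ (n + n₀ + 1)]; field_simp; norm_num
      rw [h4, ENNReal.ofReal_inv_of_pos (by positivity), ENNReal.ofReal_pow (by norm_num),
        ENNReal.rpow_neg, ENNReal.inv_rpow, inv_inv, ENNReal.ofReal_ofNat, ← pow_succ',
        ← ENNReal.rpow_natCast, ← ENNReal.rpow_natCast, ← ENNReal.rpow_mul, ← ENNReal.rpow_mul,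
        mul_comm]
    rw [h3] at h2
    calc ((H (n + (n₀ + 1))).encard : ℝ≥0∞) * γ ^ (n + (n₀ + 1))
        ≤ 2 * packingSup u δ F * ((2 : ℝ≥0∞) ^ u * ((2 : ℝ≥0∞) ^ u) ^ (n + n₀ + 1))
          * γ ^ (n + (n₀ + 1)) := by gcongr; exact h2
      _ = K * ((2 : ℝ≥0∞) ^ u * γ) ^ n * ((2 : ℝ≥0∞) ^ u * γ) ^ (n₀ + 1) := by
          rw [hK, mul_pow, mul_pow, ← add_assoc, pow_add _ (n + n₀), pow_add _ n,
            pow_add _ (n + n₀), pow_add _ n]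
          ring
      _ ≤ K * ((2 : ℝ≥0∞) ^ u * γ) ^ n * 1 := by
          gcongr
          exact pow_le_one₀ zero_le hγ.le
      _ = _ := mul_one _
  refine (ENNReal.tsum_le_tsum hle).trans_lt ?_
  rw [ENNReal.tsum_mul_left]
  exact ENNReal.mul_lt_top hKtop (tsum_geometric_lt_top.2 hγ)

/-! ### Packings of the image under the cascade function -/

theorem exists_length_mem_dyadicInterval {x : ℝ} (hx : x ∈ Icc (0 : ℝ) 1) (n : ℕ) :
    ∃ i : List Bool, i.length = n ∧ x ∈ dyadicInterval i := by
  induction n with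
  | zero => exact ⟨[], rfl, by rwa [dyadicInterval_nil]⟩
  | succ n ih =>
    obtain ⟨i, hi, hxi⟩ := ih
    rw [dyadicInterval_eq_union i] at hxi
    rcases hxi with h | h
    · exact ⟨_, by simp [hi], h⟩
    · exact ⟨_, by simp [hi], h⟩

/-- If the masses of the dyadic intervals at `x` become arbitrarily small, then either the whole
mass is at most `r`, or there is an interval at `x` of mass at most `r` whose parent has mass
larger than `r`. -/
theorem exists_maximal_interval (m : List Bool → ℝ) {x r : ℝ}
    (h : ∃ i, x ∈ dyadicInterval i ∧ m i ≤ r) :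
    m [] ≤ r ∨ ∃ v : List Bool, ∃ b : Bool,
      x ∈ dyadicInterval (v ++ [b]) ∧ m (v ++ [b]) ≤ r ∧ r < m v := by
  obtain ⟨i, hx, hi⟩ := h
  induction i using List.reverseRecOn with
  | nil => exact Or.inl hi
  | append_singleton v b ih =>
    by_cases hv : m v ≤ r
    · exact ih (dyadicInterval_append_subset v b hx) hv
    · exact Or.inr ⟨v, b, hx, hi, not_le.1 hv⟩

/-- Otherwise the intervals at x, one on each level, would all contribute more than r^s to a
convergent sum. -/
theorem exists_intervalMass_le {w : List Bool → ℝ} {F : Set ℝ} (hF : F ⊆ Icc 0 1) {s : ℝ}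
    (hs : 0 < s)
    (hsum : ∑' i : hitWords F, ENNReal.ofReal (intervalMass w i) ^ s < ∞) {x : ℝ} (hx : x ∈ F)
    {r : ℝ} (hr : 0 < r) : ∃ i, x ∈ dyadicInterval i ∧ intervalMass w i ≤ r := by
  by_contra! hcon
  choose i hlen hxi using exists_length_mem_dyadicInterval (hF hx)
  have hinj : Function.Injective
      (fun n => (⟨i n, x, hxi n, hx⟩ : hitWords F)) := by
    intro m n hmn
    have : i m = i n := congrArg Subtype.val hmn
    rw [← hlen m, ← hlen n, this]
  have h1 := ENNReal.tsum_comp_le_tsum_of_injective hinj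
    (fun j : hitWords F => ENNReal.ofReal (intervalMass w j) ^ s)
  have h2 : ∑' _ : ℕ, ENNReal.ofReal r ^ s ≤ ∑' n, ENNReal.ofReal (intervalMass w (i n)) ^ s := by
    refine ENNReal.tsum_le_tsum fun n => ?_
    gcongr
    exact (hcon _ (hxi n)).le
  rw [ENNReal.tsum_const_eq_top_of_ne_zero] at h2
  · exact absurd (h2.trans h1) (not_le.2 hsum)
  · exact (ENNReal.rpow_pos (ENNReal.ofReal_pos.2 hr) ENNReal.ofReal_ne_top).ne'

/-- Each ball is charged to the parent of its stopping interval, whose mass exceeds the radius. A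
parent is charged at most once through each of its two children, whence S + S; the 1 accounts for a
ball stopped at the root, and 2^s for passing from radius to diameter. -/
theorem packingPremeasure_image_lt_top {w : List Bool → ℝ} (hw : ∀ i, 0 ≤ w i)
    (hlim : HasLimits w) {F : Set ℝ} (hF : F ⊆ Icc 0 1) {s : ℝ} (hs : 0 < s)
    (hsum : ∑' i : hitWords F, ENNReal.ofReal (intervalMass w i) ^ s < ∞) :
    packingPremeasure s (cascadeFun w '' F) < ∞ := by
  set S := ∑' i : hitWords F, ENNReal.ofReal (intervalMass w i) ^ s with hS
  have h2top : (2 : ℝ≥0∞) ^ s < ∞ := ENNReal.rpow_lt_top_of_nonneg hs.le (by norm_num)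
  refine lt_of_le_of_lt (b := (2 : ℝ≥0∞) ^ s * (1 + (S + S))) ?_
    (ENNReal.mul_lt_top h2top (by finiteness))
  -- Taking δ = 1 bounds r^s by 1 for a ball assigned to the root.
  refine (iInf₂_le 1 one_pos).trans (iSup₂_le fun T hT => ?_)
  -- the weight of an index: `none` stands for the root, `(v, b)` for the child `v ++ [b]`
  set c : Option (hitWords F × Bool) → ℝ≥0∞ := fun o =>
    o.elim 1 fun p => ENNReal.ofReal (intervalMass w p.1) ^ s with hc
  set word : Option (hitWords F × Bool) → List Bool := fun o =>
    o.elim [] fun p => p.1.1 ++ [p.2] with hword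
  have hex : ∀ p : T, ∃ o : Option (hitWords F × Bool), ∃ x ∈ F, cascadeFun w x = p.1.1 ∧
      x ∈ dyadicInterval (word o) ∧ intervalMass w (word o) ≤ p.1.2 ∧
      ENNReal.ofReal p.1.2 ^ s ≤ c o := by
    intro p
    obtain ⟨x, hx, hxp⟩ := hT.center_mem p p.2
    have hr := hT.radius_pos p p.2
    rcases exists_maximal_interval (intervalMass w)
      (exists_intervalMass_le hF hs hsum hx hr) with h0 | ⟨v, b, hxv, hle, hlt⟩
    · refine ⟨none, x, hx, hxp, by simpa [hword, dyadicInterval_nil] using hF hx, h0, ?_⟩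
      refine ENNReal.rpow_le_one ?_ hs.le
      exact ENNReal.ofReal_le_one.2 (hT.radius_le p p.2)
    · refine ⟨some (⟨v, x, dyadicInterval_append_subset v b hxv, hx⟩, b), x, hx, hxp, hxv, hle, ?_⟩
      simp only [hc, Option.elim]
      gcongr
  choose o x hxF hxp hxo hmass hco using hex
  -- If two balls shared an interval, their centres would differ by at most its mass, hence by at
  -- most the first radius, and the balls would meet.
  have hinj : Function.Injective o := by
    intro p q hpq
    by_contra hne
    have hdisj := hT.disjoint p.2 q.2 (fun h => hne (Subtype.ext h))
    refine Set.disjoint_left.1 hdisj ?_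
      (Metric.mem_closedBall_self (x := q.1.1) (hT.radius_pos q q.2).le)
    rw [Metric.mem_closedBall, Real.dist_eq, ← hxp p, ← hxp q]
    refine (abs_cascadeFun_sub_le hw hlim (i := word (o p)) ?_ (hxo p)).trans (hmass p)
    rw [hpq]
    exact hxo q
  have hsumc : ∑' o, c o ≤ 1 + (S + S) := by
    rw [← tsum_univ, ← insert_none_range_some, ← singleton_union]
    refine (ENNReal.tsum_union_le c _ _).trans (add_le_add ?_ ?_)
    · rw [tsum_singleton]
      exact le_rfl
    · rw [tsum_range c (Option.some_injective _), ENNReal.tsum_prod', ENNReal.tsum_comm, tsum_bool]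
      exact le_rfl
  calc ∑' p : T, ENNReal.ofReal (2 * p.1.2) ^ s
      ≤ ∑' p : T, (2 : ℝ≥0∞) ^ s * c (o p) := by
        refine ENNReal.tsum_le_tsum fun p => ?_
        rw [ENNReal.ofReal_mul (by norm_num), ENNReal.mul_rpow_of_nonneg _ _ hs.le,
          ENNReal.ofReal_ofNat]
        gcongr
        exact hco p
    _ = (2 : ℝ≥0∞) ^ s * ∑' p : T, c (o p) := ENNReal.tsum_mul_left
    _ ≤ (2 : ℝ≥0∞) ^ s * (1 + (S + S)) := by
        gcongr
        exact (ENNReal.tsum_comp_le_tsum_of_injective hinj c).trans hsumc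

/-! ### The moment function `s ↦ E((W/2)^s)` -/

theorem rpow_le_one_add {x s : ℝ} (hx : 0 ≤ x) (hs : s ∈ Icc (0 : ℝ) 1) : x ^ s ≤ 1 + x := by
  rcases le_total x 1 with h | h
  · linarith [Real.rpow_le_one hx h hs.1]
  · have := Real.rpow_le_rpow_of_exponent_le h hs.2
    rw [Real.rpow_one] at this
    linarith

section

variable {Ω : Type*} [MeasurableSpace Ω] {P : Measure Ω} {W : Ω → ℝ}

theorem integrable_rpow [IsProbabilityMeasure P] {V : Ω → ℝ} (hV : Integrable V P)
    (hpos : ∀ᵐ ω ∂P, 0 < V ω) {s : ℝ} (hs : s ∈ Icc (0 : ℝ) 1) : Integrable (fun ω => V ω ^ s) P := by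
  refine ((integrable_const (1 : ℝ)).add hV).mono'
    (hV.aestronglyMeasurable.aemeasurable.pow_const s).aestronglyMeasurable ?_
  filter_upwards [hpos] with ω hω
  rw [Real.norm_of_nonneg (Real.rpow_nonneg hω.le s)]
  exact rpow_le_one_add hω.le hs

/-- `E((W/2)^s)`. -/
def halfMoment (P : Measure Ω) (W : Ω → ℝ) (s : ℝ) : ℝ := ∫ ω, (W ω / 2) ^ s ∂P

theorem halfMoment_zero [IsProbabilityMeasure P] : halfMoment P W 0 = 1 := by
  simp [halfMoment]

variable (hW : IsSubcritical P W)
include hW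

theorem halfMoment_eq (s : ℝ) : halfMoment P W s = (∫ ω, W ω ^ s ∂P) / 2 ^ s := by
  rw [halfMoment, ← integral_div]
  refine integral_congr_ae ?_
  filter_upwards [hW.pos] with ω hω
  exact Real.div_rpow hω.le zero_le_two s

theorem half_pos : ∀ᵐ ω ∂P, 0 < W ω / 2 := by
  filter_upwards [hW.pos] with ω hω
  linarith

theorem halfMoment_one : halfMoment P W 1 = 1 / 2 := by
  rw [halfMoment_eq hW]
  simp [hW.mean_one]

theorem eq_div_iff_halfMoment {s d : ℝ} :
    (2 : ℝ) ^ d = 2 ^ s / ∫ ω, W ω ^ s ∂P ↔ halfMoment P W s = 2 ^ (-d) := by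
  rw [← inv_div, ← halfMoment_eq hW, Real.rpow_neg zero_le_two, ← inv_inj, inv_inv, eq_comm]

variable [IsProbabilityMeasure P]

theorem integrable_half_rpow {s : ℝ} (hs : s ∈ Icc (0 : ℝ) 1) :
    Integrable (fun ω => (W ω / 2) ^ s) P :=
  integrable_rpow (hW.integrable.div_const 2) (half_pos hW) hs

theorem convexOn_halfMoment : ConvexOn ℝ (Icc 0 1) (halfMoment P W) := by
  refine ⟨convex_Icc 0 1, fun s hs t ht a b ha hb hab => ?_⟩
  simp only [halfMoment, smul_eq_mul]
  rw [← integral_const_mul, ← integral_const_mul, ← integral_add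
    ((integrable_half_rpow hW hs).const_mul a) ((integrable_half_rpow hW ht).const_mul b)]
  refine integral_mono_ae (integrable_half_rpow hW (convex_Icc 0 1 hs ht ha hb hab))
    (((integrable_half_rpow hW hs).const_mul a).add
      ((integrable_half_rpow hW ht).const_mul b)) ?_
  filter_upwards [half_pos hW] with ω hω
  exact (convexOn_rpow_left hω).2 (mem_univ s) (mem_univ t) ha hb hab

theorem continuousOn_halfMoment : ContinuousOn (halfMoment P W) (Icc 0 1) := by
  refine continuousOn_of_dominated (bound := fun ω => 1 + W ω / 2) ?_ ?_
    ((integrable_const _).add (hW.integrable.div_const 2)) ?_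
  · exact fun s hs => (integrable_half_rpow hW hs).aestronglyMeasurable
  · intro s hs
    filter_upwards [half_pos hW] with ω hω
    rw [Real.norm_of_nonneg (Real.rpow_nonneg hω.le s)]
    exact rpow_le_one_add hω.le hs
  · filter_upwards [half_pos hW] with ω hω
    exact (Real.continuous_const_rpow hω.ne').continuousOn

/-- With V = W/2, the inequality e^y ≥ 1 + y gives V^s ≥ V(1 + (s-1) log V). Taking expectations,
the gain over 1/2 is (1-s)(log 2/2)(1 - E(W log₂ W)), positive by subcriticality. -/
theorem halfMoment_one_lt {s : ℝ} (hs : s ∈ Ico (0 : ℝ) 1) :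
    halfMoment P W 1 < halfMoment P W s := by
  have hlog2 : 0 < Real.log 2 := Real.log_pos one_lt_two
  have hint : Integrable (fun ω => W ω * Real.logb 2 (W ω) - W ω) P :=
    hW.integrable_mul_logb.sub hW.integrable
  have hle : ∫ ω, (W ω / 2 + (s - 1) * (Real.log 2 / 2) * (W ω * Real.logb 2 (W ω) - W ω)) ∂P
      ≤ halfMoment P W s := by
    refine integral_mono_ae ((hW.integrable.div_const 2).add (hint.const_mul _))
      (integrable_half_rpow hW (Ico_subset_Icc_self hs)) ?_
    filter_upwards [hW.pos] with ω hω
    have hV : 0 < W ω / 2 := by linarith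
    have h1 : (W ω / 2) ^ s = W ω / 2 * Real.exp ((s - 1) * Real.log (W ω / 2)) := by
      rw [mul_comm (s - 1), ← Real.rpow_def_of_pos hV, Real.rpow_sub hV, Real.rpow_one]
      field_simp
    have h2 := Real.add_one_le_exp ((s - 1) * Real.log (W ω / 2))
    rw [h1]
    refine le_trans (le_of_eq ?_) (mul_le_mul_of_nonneg_left h2 hV.le)
    rw [Real.log_div hω.ne' two_ne_zero, Real.logb]
    field_simp
    ring
  refine lt_of_lt_of_le ?_ hle
  rw [integral_add (hW.integrable.div_const 2) (hint.const_mul _), integral_const_mul,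
    integral_sub hW.integrable_mul_logb hW.integrable, integral_div, hW.mean_one,
    halfMoment_one hW]
  have h3 := hW.subcritical
  have h4 : 0 < (1 - s) * (Real.log 2 / 2) := mul_pos (by linarith [hs.2]) (by linarith)
  nlinarith

/-- For s < t < 1 write t = a·s + (1-a)·1. Convexity bounds the value at t by the corresponding
average of the values at s and 1; the value at 1 is smaller than that at t, so the value at s must
be larger. -/
theorem strictAntiOn_halfMoment : StrictAntiOn (halfMoment P W) (Icc 0 1) := by
  intro s hs t ht hst
  have hs1 : s < 1 := hst.trans_le ht.2
  rcases eq_or_lt_of_le ht.2 with h1 | h1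
  · rw [h1]
    exact halfMoment_one_lt hW ⟨hs.1, hs1⟩
  have hlt := halfMoment_one_lt hW ⟨ht.1, h1⟩
  set a : ℝ := (1 - t) / (1 - s) with ha
  have hd : 0 < 1 - s := by linarith
  have ha0 : 0 < a := div_pos (by linarith) hd
  have ha1 : a < 1 := (div_lt_one hd).2 (by linarith)
  have hc := (convexOn_halfMoment hW).2 hs (right_mem_Icc.2 zero_le_one) ha0.le
    (sub_nonneg.2 ha1.le) (add_sub_cancel _ _)
  have hcomb : a • s + (1 - a) • (1 : ℝ) = t := by
    simp only [smul_eq_mul, ha]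
    field_simp
    ring
  rw [hcomb] at hc
  simp only [smul_eq_mul] at hc
  nlinarith

theorem existsUnique_moment_eq {d : ℝ} (hd0 : 0 ≤ d) (hd1 : d ≤ 1) :
    ∃! s : ℝ, s ∈ Icc (0 : ℝ) 1 ∧ (2 : ℝ) ^ d = 2 ^ s / ∫ ω, W ω ^ s ∂P := by
  have hmem : (2 : ℝ) ^ (-d) ∈ Icc (halfMoment P W 1) (halfMoment P W 0) := by
    rw [halfMoment_one hW, halfMoment_zero]
    refine ⟨?_, Real.rpow_le_one_of_one_le_of_nonpos one_le_two (by linarith)⟩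
    have := Real.rpow_le_rpow_of_exponent_le (x := 2) one_le_two (neg_le_neg hd1)
    rwa [Real.rpow_neg_one, ← one_div] at this
  obtain ⟨s, hs, hgs⟩ :=
    intermediate_value_Icc' zero_le_one (continuousOn_halfMoment hW) hmem
  refine ⟨s, ⟨hs, (eq_div_iff_halfMoment hW).2 hgs⟩, ?_⟩
  rintro t ⟨ht, hgt⟩
  refine (strictAntiOn_halfMoment hW).injOn ht hs ?_
  rw [hgs, (eq_div_iff_halfMoment hW).1 hgt]

/-- The moment equation has no negative solutions. -/
theorem nonneg_of_moment_eq {s d : ℝ} (hd : 0 ≤ d)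
    (h : (2 : ℝ) ^ d = 2 ^ s / ∫ ω, W ω ^ s ∂P) : 0 ≤ s := by
  by_contra! hs
  have h1 : (1 : ℝ) ≤ 2 ^ d := Real.one_le_rpow one_le_two hd
  -- A non-integrable W^s would have integral 0 by convention, making the quotient 0, whereas 2^d ≥
  -- 1.
  have hint : Integrable (fun ω => W ω ^ s) P := by
    by_contra hni
    rw [integral_undef hni, div_zero] at h
    linarith
  -- For s < 0, W^s ≥ 1 + s log W ≥ 1 + s(W - 1), and the last expression has mean 1.
  have h2 : 1 ≤ ∫ ω, W ω ^ s ∂P := by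
    have hsub : Integrable (fun ω => W ω - 1) P := hW.integrable.sub (integrable_const _)
    have hle : ∫ ω, (1 + s * (W ω - 1)) ∂P ≤ ∫ ω, W ω ^ s ∂P := by
      refine integral_mono_ae ((integrable_const _).add (hsub.const_mul _)) hint ?_
      filter_upwards [hW.pos] with ω hω
      have h3 := Real.add_one_le_exp (Real.log (W ω) * s)
      have h4 := Real.log_le_sub_one_of_pos hω
      rw [Real.rpow_def_of_pos hω]
      nlinarith
    rw [integral_add (integrable_const _) (hsub.const_mul _), integral_const_mul,
      integral_sub hW.integrable (integrable_const _), hW.mean_one] at hle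
    simpa using hle
  have h5 : (2 : ℝ) ^ s < 1 := Real.rpow_lt_one_of_one_lt_of_neg one_lt_two hs
  have h6 : (2 : ℝ) ^ s / ∫ ω, W ω ^ s ∂P ≤ 2 ^ s := div_le_self (by positivity) h2
  linarith

end

/-! ### Moments of the masses, and existence of the limits -/

section

variable {Ω : Type*}

/-- The σ-algebra generated by the weights with index in `T`. -/
@[reducible]
def weightAlgebra (X : List Bool → Ω → ℝ) (T : Set (List Bool)) : MeasurableSpace Ω :=
  ⨆ i ∈ T, MeasurableSpace.comap (X i) inferInstance

variable {X : List Bool → Ω → ℝ}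

theorem weightAlgebra_mono {S T : Set (List Bool)} (h : S ⊆ T) :
    weightAlgebra X S ≤ weightAlgebra X T :=
  biSup_mono h

theorem measurable_weight {T : Set (List Bool)} {i : List Bool} (hi : i ∈ T) :
    Measurable[weightAlgebra X T] (X i) :=
  (comap_measurable (X i)).mono
    (le_iSup₂ (f := fun j (_ : j ∈ T) => MeasurableSpace.comap (X j) inferInstance) i hi) le_rfl

theorem measurable_pathWeight {T : Set (List Bool)} {i j : List Bool}
    (h : ∀ m < j.length, i ++ j.take (m + 1) ∈ T) :
    Measurable[weightAlgebra X T] (fun ω => pathWeight (fun k => X k ω) i j) :=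
  Finset.measurable_prod _ fun m hm => measurable_weight (h m (Finset.mem_range.1 hm))

theorem measurable_partialLength {T : Set (List Bool)} {i : List Bool} {n : ℕ}
    (h : ∀ j : List Bool, j.length = n → ∀ m < n, i ++ j.take (m + 1) ∈ T) :
    Measurable[weightAlgebra X T] (fun ω => partialLength (fun k => X k ω) i n) :=
  Finset.measurable_sum _ fun j _ => Measurable.const_mul
    (measurable_pathWeight fun m hm => h _ (by simp) m (by simpa using hm)) _

/-- The mass of `I_i`, with `L_i` as a lower limit. -/
def liminfMass (X : List Bool → Ω → ℝ) (i : List Bool) (ω : Ω) : ℝ≥0∞ :=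
  ENNReal.ofReal (((2 : ℝ) ^ i.length)⁻¹ * pathWeight (fun k => X k ω) [] i)
    * liminf (fun n => ENNReal.ofReal (partialLength (fun k => X k ω) i n)) atTop

/-- Unlike `limUnder`, the lower limit is evidently measurable and open to Fatou's lemma; the two
agree wherever the limits exist. -/
theorem ofReal_intervalMass_eq {ω : Ω} (h0 : ∀ i, 0 ≤ X i ω) (hlim : HasLimits fun k => X k ω)
    (i : List Bool) :
    ENNReal.ofReal (intervalMass (fun k => X k ω) i) = liminfMass X i ω := by
  rw [intervalMass, ENNReal.ofReal_mul (mul_nonneg (by positivity) (pathWeight_nonneg h0 _ _)),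
    liminfMass, ((ENNReal.continuous_ofReal.tendsto _).comp
      (tendsto_limitLength hlim i)).liminf_eq.symm]
  rfl

/-- Only weights strictly below level |i| enter L_i, which makes it independent of the path weight
leading to i. -/
theorem measurable_liminf_partialLength (i : List Bool) :
    Measurable[weightAlgebra X {k | i.length < k.length}]
      (fun ω => liminf (fun n => ENNReal.ofReal (partialLength (fun k => X k ω) i n)) atTop) :=
  Measurable.liminf fun n => ENNReal.measurable_ofReal.comp
    (measurable_partialLength fun j hj m hm => by simp; omega)

variable [mΩ : MeasurableSpace Ω] {P : Measure Ω}

theorem integrable_of_lintegral_ofReal_eq_one {f : Ω → ℝ} (hf : Measurable f) (hf0 : ∀ ω, 0 ≤ f ω)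
    (h : ∫⁻ ω, ENNReal.ofReal (f ω) ∂P = 1) : Integrable f P := by
  refine ⟨hf.aestronglyMeasurable, ?_⟩
  rw [hasFiniteIntegral_iff_ofReal (ae_of_all _ hf0), h]
  exact ENNReal.one_lt_top

/-- A family of independent, measurable, nonnegative weights of mean one. -/
structure IsWeightFamily (P : Measure Ω) (X : List Bool → Ω → ℝ) : Prop where
  measurable : ∀ i, Measurable (X i)
  indep : iIndepFun X P
  nonneg : ∀ i ω, 0 ≤ X i ω
  mean_one : ∀ i, ∫⁻ ω, ENNReal.ofReal (X i ω) ∂P = 1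

variable (hX : IsWeightFamily P X)
include hX

theorem weightAlgebra_le (T : Set (List Bool)) : weightAlgebra X T ≤ mΩ :=
  iSup₂_le fun i _ => (hX.measurable i).comap_le

theorem indep_weightAlgebra {S T : Set (List Bool)} (h : Disjoint S T) :
    Indep (weightAlgebra X S) (weightAlgebra X T) P :=
  indep_iSup_of_disjoint (fun i => (hX.measurable i).comap_le) hX.indep h

theorem integrable_weight (i : List Bool) : Integrable (X i) P :=
  integrable_of_lintegral_ofReal_eq_one (hX.measurable i) (hX.nonneg i) (hX.mean_one i)

theorem integral_weight (i : List Bool) : ∫ ω, X i ω ∂P = 1 := by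
  rw [integral_eq_lintegral_of_nonneg_ae (ae_of_all _ (hX.nonneg i)) (hX.measurable i).aestronglyMeasurable,
    hX.mean_one]
  rfl

/-- The filtration generated by the weights of the first `|i| + n` levels. -/
def levelFiltration (i : List Bool) : Filtration ℕ mΩ where
  seq n := weightAlgebra X {k | k.length ≤ i.length + n}
  mono' _ _ h := weightAlgebra_mono fun _ hk => le_trans hk (Nat.add_le_add_left h _)
  le' _ := weightAlgebra_le hX _

variable [IsProbabilityMeasure P]

theorem lintegral_pathWeight_rpow {s : ℝ} (hs : 0 ≤ s) {κ : ℝ≥0∞}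
    (hκ : ∀ i, ∫⁻ ω, ENNReal.ofReal (X i ω) ^ s ∂P = κ) (i j : List Bool) :
    ∫⁻ ω, ENNReal.ofReal (pathWeight (fun k => X k ω) i j) ^ s ∂P = κ ^ j.length := by
  induction j using List.reverseRecOn with
  | nil => simp [pathWeight]
  | append_singleton j b ih =>
    simp only [pathWeight_append_singleton]
    have h1 : ∀ ω, ENNReal.ofReal (pathWeight (fun k => X k ω) i j * X (i ++ j ++ [b]) ω) ^ s
        = ENNReal.ofReal (pathWeight (fun k => X k ω) i j) ^ s
          * ENNReal.ofReal (X (i ++ j ++ [b]) ω) ^ s := by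
      intro ω
      rw [ENNReal.ofReal_mul' (hX.nonneg _ _), ENNReal.mul_rpow_of_nonneg _ _ hs]
    simp only [h1]
    have hdisj : Disjoint {k : List Bool | k.length ≤ i.length + j.length} {i ++ j ++ [b]} := by
      rw [Set.disjoint_singleton_right]
      simp
    have hf : Measurable[weightAlgebra X {k | k.length ≤ i.length + j.length}]
        (fun ω => pathWeight (fun k => X k ω) i j) :=
      measurable_pathWeight fun m hm => by simp
    have hg : Measurable[weightAlgebra X {i ++ j ++ [b]}] (X (i ++ j ++ [b])) :=
      measurable_weight rfl
    rw [lintegral_mul_eq_lintegral_mul_lintegral_of_independent_measurableSpace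
      (weightAlgebra_le hX _) (weightAlgebra_le hX _) (indep_weightAlgebra hX hdisj)
      (hf.ennreal_ofReal.pow_const s) (hg.ennreal_ofReal.pow_const s), ih, hκ, List.length_append,
      List.length_singleton, pow_succ]

theorem lintegral_pathWeight (i j : List Bool) :
    ∫⁻ ω, ENNReal.ofReal (pathWeight (fun k => X k ω) i j) ∂P = 1 := by
  simpa using lintegral_pathWeight_rpow hX (s := 1) zero_le_one (κ := 1)
    (by simpa using hX.mean_one) i j

theorem lintegral_partialLength (i : List Bool) (n : ℕ) :
    ∫⁻ ω, ENNReal.ofReal (partialLength (fun k => X k ω) i n) ∂P = 1 := by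
  have h1 : ∀ ω, ENNReal.ofReal (partialLength (fun k => X k ω) i n)
      = ∑ j : Fin n → Bool, ENNReal.ofReal ((2 : ℝ) ^ n)⁻¹
        * ENNReal.ofReal (pathWeight (fun k => X k ω) i (List.ofFn j)) := by
    intro ω
    rw [partialLength, ENNReal.ofReal_sum_of_nonneg fun j _ =>
      mul_nonneg (by positivity) (pathWeight_nonneg (fun k => hX.nonneg k ω) _ _)]
    exact Finset.sum_congr rfl fun j _ => ENNReal.ofReal_mul (by positivity)
  have hmeas : ∀ j : List Bool,
      Measurable (fun ω => ENNReal.ofReal (pathWeight (fun k => X k ω) i j)) := fun j =>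
    ENNReal.measurable_ofReal.comp
      ((measurable_pathWeight (T := univ) fun _ _ => mem_univ _).mono (weightAlgebra_le hX _) le_rfl)
  simp only [h1]
  rw [lintegral_finsetSum _ fun j _ => (hmeas _).const_mul _]
  simp only [lintegral_const_mul _ (hmeas _), lintegral_pathWeight hX, mul_one]
  rw [Finset.sum_const, Finset.card_univ, Fintype.card_fun, Fintype.card_bool, Fintype.card_fin,
    nsmul_eq_mul, ENNReal.ofReal_inv_of_pos (by positivity), ENNReal.ofReal_pow (by norm_num)]
  push_cast
  rw [ENNReal.ofReal_ofNat]
  exact ENNReal.mul_inv_cancel (by simp) (by simp)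

/-- Passing to the next level multiplies each summand by the average of two new weights, which has
mean 1 and is independent of the past. -/
theorem martingale_partialLength (i : List Bool) :
    Martingale (fun n ω => partialLength (fun k => X k ω) i n) (levelFiltration hX i) P := by
  have hmeas : ∀ n, Measurable[levelFiltration hX i n]
      (fun ω => partialLength (fun k => X k ω) i n) := fun n =>
    measurable_partialLength fun j hj m hm => by simp; omega
  have hint : ∀ n, Integrable (fun ω => partialLength (fun k => X k ω) i n) P := fun n =>
    integrable_of_lintegral_ofReal_eq_one ((hmeas n).mono ((levelFiltration hX i).le n) le_rfl)
      (fun ω => partialLength_nonneg (fun k => hX.nonneg k ω) i n)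
      (lintegral_partialLength hX i n)
  refine martingale_nat (fun n => (hmeas n).stronglyMeasurable) hint fun n => ?_
  change _ =ᵐ[P] P[_ | weightAlgebra X {k | k.length ≤ i.length + n}]
  set A : (Fin n → Bool) → Ω → ℝ := fun j ω =>
    ((2 : ℝ) ^ n)⁻¹ * pathWeight (fun k => X k ω) i (List.ofFn j) with hA
  set B : (Fin n → Bool) → Ω → ℝ := fun j ω =>
    2⁻¹ * (X (i ++ List.ofFn j ++ [false]) ω + X (i ++ List.ofFn j ++ [true]) ω) with hB
  have hAm : ∀ j, Measurable[weightAlgebra X {k | k.length ≤ i.length + n}] (A j) := fun j =>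
    Measurable.const_mul (measurable_pathWeight fun m hm => by
      simp at hm ⊢) _
  have hAint : ∀ j, Integrable (A j) P := fun j =>
    (integrable_of_lintegral_ofReal_eq_one
      ((measurable_pathWeight (T := univ) fun _ _ => mem_univ _).mono (weightAlgebra_le hX _) le_rfl)
      (fun ω => pathWeight_nonneg (fun k => hX.nonneg k ω) _ _)
      (lintegral_pathWeight hX _ _)).const_mul _
  have hBint : ∀ j, Integrable (B j) P := fun j =>
    ((integrable_weight hX _).add (integrable_weight hX _)).const_mul _
  set T : Set (List Bool) := {k | i.length + n < k.length}
  have hBm : ∀ j, Measurable[weightAlgebra X T] (B j) := fun j =>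
    ((measurable_weight (by simp [T])).add (measurable_weight (by simp [T]))).const_mul _
  have hindep : Indep (weightAlgebra X {k | k.length ≤ i.length + n}) (weightAlgebra X T) P :=
    indep_weightAlgebra hX (Set.disjoint_left.2 fun k hk hk' => (Nat.lt_of_lt_of_le hk' hk).false)
  have hABint : ∀ j, Integrable (A j * B j) P := fun j =>
    IndepFun.integrable_mul
      (indep_of_indep_of_le_left (indep_of_indep_of_le_right hindep (hBm j).comap_le)
        (hAm j).comap_le) (hAint j) (hBint j)
  have hBcond : ∀ j, P[B j | weightAlgebra X {k | k.length ≤ i.length + n}] =ᵐ[P] fun _ => 1 := by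
    intro j
    refine (condExp_indep_eq (weightAlgebra_le hX T) (weightAlgebra_le hX _) (hBm j).stronglyMeasurable
      hindep.symm).trans (ae_of_all _ fun _ => ?_)
    simp only [hB]
    rw [integral_const_mul, integral_add (integrable_weight hX _)
      (integrable_weight hX _), integral_weight hX,
      integral_weight hX]
    norm_num
  have hsucc : (fun ω => partialLength (fun k => X k ω) i (n + 1)) = ∑ j, A j * B j := by
    funext ω
    rw [partialLength_succ_snoc, Finset.sum_apply]
    rfl
  have hcond : ∀ j, P[A j * B j | weightAlgebra X {k | k.length ≤ i.length + n}] =ᵐ[P] A j := by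
    intro j
    refine (condExp_mul_of_stronglyMeasurable_left (hAm j).stronglyMeasurable (hABint j)
      (hBint j)).trans ?_
    filter_upwards [hBcond j] with ω hω
    rw [Pi.mul_apply, hω, mul_one]
  rw [hsucc]
  refine EventuallyEq.symm ((condExp_finsetSum (fun j _ => hABint j) _).trans ?_)
  filter_upwards [ae_all_iff.2 hcond] with ω hω
  rw [Finset.sum_apply, partialLength]
  exact Finset.sum_congr rfl fun j _ => hω j

theorem ae_hasLimits : ∀ᵐ ω ∂P, HasLimits (fun k => X k ω) := by
  refine ae_all_iff.2 fun i => ?_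
  refine (martingale_partialLength hX i).submartingale.exists_ae_tendsto_of_bdd
    (R := 1) fun n => le_of_eq ?_
  rw [eLpNorm_one_eq_lintegral_enorm, ENNReal.coe_one,
    ← lintegral_partialLength hX i n]
  exact lintegral_congr fun ω =>
    Real.enorm_of_nonneg (partialLength_nonneg (fun k => hX.nonneg k ω) i n)

/-- The path weight and L_i are independent. The former contributes κ^|i|; for the latter, L^s ≤ 1 +
L and Fatou's bound E(L) ≤ 1 give the factor 2. -/
theorem lintegral_liminfMass_rpow_le {s : ℝ} (hs : s ∈ Icc (0 : ℝ) 1) {κ : ℝ≥0∞}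
    (hκ : ∀ i, ∫⁻ ω, ENNReal.ofReal (X i ω) ^ s ∂P = κ) (i : List Bool) :
    ∫⁻ ω, liminfMass X i ω ^ s ∂P ≤ ((2 : ℝ≥0∞) ^ (-s) * κ) ^ i.length * 2 := by
  set l : Ω → ℝ≥0∞ := fun ω =>
    liminf (fun n => ENNReal.ofReal (partialLength (fun k => X k ω) i n)) atTop with hl
  have hpw : Measurable[weightAlgebra X {k | k.length ≤ i.length}]
      (fun ω => pathWeight (fun k => X k ω) [] i) :=
    measurable_pathWeight fun m hm => by simp
  have hlm := measurable_liminf_partialLength (X := X) i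
  have h1 : ∀ ω, liminfMass X i ω ^ s = ((2 : ℝ≥0∞) ^ (-s)) ^ i.length *
      (ENNReal.ofReal (pathWeight (fun k => X k ω) [] i) ^ s * l ω ^ s) := by
    intro ω
    have h2 : ENNReal.ofReal ((2 : ℝ) ^ i.length)⁻¹ ^ s = ((2 : ℝ≥0∞) ^ (-s)) ^ i.length := by
      rw [ENNReal.ofReal_inv_of_pos (by positivity), ENNReal.ofReal_pow (by norm_num),
        ENNReal.inv_rpow, ENNReal.ofReal_ofNat, ← ENNReal.rpow_neg,
        ← ENNReal.rpow_natCast, ← ENNReal.rpow_natCast, ← ENNReal.rpow_mul, ← ENNReal.rpow_mul,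
        mul_comm]
    rw [liminfMass, ENNReal.ofReal_mul (by positivity), mul_assoc,
      ENNReal.mul_rpow_of_nonneg _ _ hs.1, ENNReal.mul_rpow_of_nonneg _ _ hs.1, h2]
  have hlint : ∫⁻ ω, l ω ∂P ≤ 1 := by
    refine (lintegral_liminf_le fun n => Measurable.ennreal_ofReal
      ((measurable_partialLength (T := univ) fun _ _ _ _ => mem_univ _).mono
        (weightAlgebra_le hX _) le_rfl)).trans ?_
    simp only [lintegral_partialLength hX, liminf_const, le_refl]
  have hls : ∫⁻ ω, l ω ^ s ∂P ≤ 2 := by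
    calc ∫⁻ ω, l ω ^ s ∂P ≤ ∫⁻ ω, (1 + l ω) ∂P := by
          refine lintegral_mono fun ω => ?_
          rcases le_total (l ω) 1 with h | h
          · exact (ENNReal.rpow_le_one h hs.1).trans le_self_add
          · refine le_trans ?_ le_add_self
            simpa using ENNReal.rpow_le_rpow_of_exponent_le h hs.2
      _ = 1 + ∫⁻ ω, l ω ∂P := by
          rw [lintegral_add_left measurable_const, lintegral_one, measure_univ]
      _ ≤ 1 + 1 := by gcongr
      _ = 2 := one_add_one_eq_two
  have hm1 : Measurable[weightAlgebra X {k | k.length ≤ i.length}]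
      (fun ω => ENNReal.ofReal (pathWeight (fun k => X k ω) [] i) ^ s) :=
    (ENNReal.measurable_ofReal.comp hpw).pow_const s
  have hm2 : Measurable[weightAlgebra X {k | i.length < k.length}] (fun ω => l ω ^ s) :=
    hlm.pow_const s
  simp only [h1]
  have hm12 : Measurable fun ω =>
      ENNReal.ofReal (pathWeight (fun k => X k ω) [] i) ^ s * l ω ^ s :=
    (hm1.mono (weightAlgebra_le hX _) le_rfl).mul (hm2.mono (weightAlgebra_le hX _) le_rfl)
  rw [lintegral_const_mul _ hm12,
    lintegral_mul_eq_lintegral_mul_lintegral_of_independent_measurableSpace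
      (weightAlgebra_le hX _) (weightAlgebra_le hX _) (indep_weightAlgebra hX
        (Set.disjoint_left.2 fun k hk hk' => (Nat.lt_of_lt_of_le hk' hk).false)) hm1 hm2,
    lintegral_pathWeight_rpow hX hs.1 hκ, mul_pow, mul_assoc]
  gcongr

theorem ae_packingPremeasure_image_lt_top {s : ℝ} (hs : s ∈ Ioc (0 : ℝ) 1) {κ : ℝ≥0∞}
    (hκ : ∀ i, ∫⁻ ω, ENNReal.ofReal (X i ω) ^ s ∂P = κ) {F : Set ℝ} (hF : F ⊆ Icc 0 1) {u : ℝ}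
    (hFu : packingPremeasure u F < ∞) (hu : (2 : ℝ≥0∞) ^ u * ((2 : ℝ≥0∞) ^ (-s) * κ) < 1) :
    ∀ᵐ ω ∂P, packingPremeasure s (cascadeFun (fun k => X k ω) '' F) < ∞ := by
  have hmeas : ∀ i, Measurable fun ω => liminfMass X i ω ^ s := by
    intro i
    refine Measurable.pow_const (Measurable.mul (ENNReal.measurable_ofReal.comp
      (Measurable.const_mul ?_ _)) ?_) s
    · exact (measurable_pathWeight (T := univ) fun _ _ => mem_univ _).mono
        (weightAlgebra_le hX _) le_rfl
    · exact (measurable_liminf_partialLength i).mono (weightAlgebra_le hX _) le_rfl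
  have hfin : ∫⁻ ω, ∑' i : hitWords F, liminfMass X i ω ^ s ∂P < ∞ := by
    rw [lintegral_tsum fun i : hitWords F => (hmeas i).aemeasurable]
    refine (ENNReal.tsum_le_tsum fun i : hitWords F =>
      lintegral_liminfMass_rpow_le hX (Ioc_subset_Icc_self hs) hκ i.1).trans_lt ?_
    rw [ENNReal.tsum_mul_right]
    exact ENNReal.mul_lt_top (tsum_hitWords_lt_top hFu hu) (by norm_num)
  filter_upwards [ae_lt_top (Measurable.tsum fun i : hitWords F => hmeas i) hfin.ne,
    ae_hasLimits hX] with ω hω hlim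
  refine packingPremeasure_image_lt_top (fun k => hX.nonneg k ω) hlim hF hs.1 ?_
  simpa only [ofReal_intervalMass_eq (fun k => hX.nonneg k ω) hlim] using hω

end

/-! ### The dimension of the image -/

section

variable {Ω₀ : Type*} [MeasurableSpace Ω₀] {P₀ : Measure Ω₀} [IsProbabilityMeasure P₀]
  {W : Ω₀ → ℝ} (hW : IsSubcritical P₀ W)
  {Ω : Type*} [MeasurableSpace Ω] {P : Measure Ω}
  {Wt : List Bool → Ω → ℝ} (hdistrib : ∀ i, IdentDistrib (Wt i) W P P₀)
include hW

theorem lintegral_ofReal_rpow {s : ℝ} (hs : s ∈ Icc (0 : ℝ) 1) :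
    ∫⁻ ω, ENNReal.ofReal (W ω) ^ s ∂P₀ = ENNReal.ofReal (∫ ω, W ω ^ s ∂P₀) := by
  rw [ofReal_integral_eq_lintegral_ofReal (integrable_rpow hW.integrable hW.pos hs)]
  · refine lintegral_congr_ae ?_
    filter_upwards [hW.pos] with ω hω
    exact ENNReal.ofReal_rpow_of_pos hω
  · filter_upwards [hW.pos] with ω hω
    exact Real.rpow_nonneg hω.le s

include hdistrib

/-- The weights agree almost surely with measurable, everywhere nonnegative ones. -/
theorem exists_isWeightFamily (hindep : iIndepFun Wt P) :
    ∃ X : List Bool → Ω → ℝ, IsWeightFamily P X ∧ (∀ᵐ ω ∂P, ∀ i, Wt i ω = X i ω) ∧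
      ∀ s ∈ Icc (0 : ℝ) 1, ∀ i,
        ∫⁻ ω, ENNReal.ofReal (X i ω) ^ s ∂P = ENNReal.ofReal (∫ ω, W ω ^ s ∂P₀) := by
  have hm : ∀ i, AEMeasurable (Wt i) P := fun i => (hdistrib i).aemeasurable_fst
  have hpos : ∀ i, ∀ᵐ ω ∂P, 0 < Wt i ω := fun i =>
    (hdistrib i).symm.ae_snd measurableSet_Ioi hW.pos
  -- The absolute value makes the measurable version nonnegative everywhere without changing it
  -- almost surely.
  have hae : ∀ i, Wt i =ᵐ[P] fun ω => |(hm i).mk (Wt i) ω| := by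
    intro i
    filter_upwards [hpos i, (hm i).ae_eq_mk] with ω h1 h2
    rw [← h2, abs_of_pos h1]
  have hmom : ∀ s ∈ Icc (0 : ℝ) 1, ∀ i,
      ∫⁻ ω, ENNReal.ofReal |(hm i).mk (Wt i) ω| ^ s ∂P
        = ENNReal.ofReal (∫ ω, W ω ^ s ∂P₀) := by
    intro s hs i
    rw [← lintegral_ofReal_rpow hW hs]
    refine Eq.trans (lintegral_congr_ae ?_) ((hdistrib i).comp
      (u := fun x => ENNReal.ofReal x ^ s) (ENNReal.measurable_ofReal.pow_const s)).lintegral_eq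
    filter_upwards [hae i] with ω hω
    simp only [Function.comp_apply, hω]
  refine ⟨fun i ω => |(hm i).mk (Wt i) ω|, ⟨?_, ?_, ?_, ?_⟩, ae_all_iff.2 hae, hmom⟩
  · exact fun i => (hm i).measurable_mk.abs
  · exact hindep.congr hae
  · exact fun i ω => abs_nonneg _
  · intro i
    simpa [hW.mean_one] using hmom 1 (right_mem_Icc.2 zero_le_one) i

variable [IsProbabilityMeasure P]

theorem ae_packingDim_image_le_of_lt (hindep : iIndepFun Wt P) {E : Set ℝ} (hE : E ⊆ Icc 0 1)
    {d : ℝ≥0} (hd : packingDim E = d) {s : ℝ} (hs : s ∈ Ioc (0 : ℝ) 1)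
    (hlt : halfMoment P₀ W s < 2 ^ (-(d : ℝ))) :
    ∀ᵐ ω ∂P, packingDim (cascadeFun (fun i => Wt i ω) '' E) ≤ ENNReal.ofReal s := by
  obtain ⟨X, hX, hWX, hmom⟩ := exists_isWeightFamily hW hdistrib hindep
  have hpos : 0 < halfMoment P₀ W s := by
    have h1 := (strictAntiOn_halfMoment hW).antitoneOn (Ioc_subset_Icc_self hs)
      (right_mem_Icc.2 zero_le_one) hs.2
    rw [halfMoment_one hW] at h1
    linarith
  -- Here t solves 2^(-t) = g(s), so d < t and any u < t gives 2^u g(s) = 2^(u-t) < 1.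
  set t : ℝ := -Real.logb 2 (halfMoment P₀ W s) with ht
  have h2t : (2 : ℝ) ^ (-t) = halfMoment P₀ W s := by
    rw [ht, neg_neg, Real.rpow_logb two_pos (by norm_num) hpos]
  have hdt : (d : ℝ) < t := by
    rw [← h2t, Real.rpow_lt_rpow_left_iff one_lt_two] at hlt
    linarith
  obtain ⟨u, hut, A, hA, hfin⟩ := exists_cover_of_packingDim_lt (F := E) (t := t.toNNReal)
    (by rw [hd]; exact_mod_cast Real.lt_toNNReal_iff_coe_lt.2 hdt)
  have hut' : (u : ℝ) < t := Real.lt_toNNReal_iff_coe_lt.1 hut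
  have hκ : (2 : ℝ≥0∞) ^ (u : ℝ) * ((2 : ℝ≥0∞) ^ (-s) * ENNReal.ofReal (∫ ω, W ω ^ s ∂P₀)) < 1 := by
    rw [← ENNReal.ofReal_ofNat 2, ENNReal.ofReal_rpow_of_pos two_pos,
      ENNReal.ofReal_rpow_of_pos two_pos, ← ENNReal.ofReal_mul (by positivity),
      ← ENNReal.ofReal_mul (by positivity), ENNReal.ofReal_lt_one]
    have h3 : (2 : ℝ) ^ (-s) * ∫ ω, W ω ^ s ∂P₀ = 2 ^ (-t) := by
      rw [h2t, halfMoment_eq hW, Real.rpow_neg zero_le_two]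
      ring
    rw [h3, ← Real.rpow_add two_pos]
    exact Real.rpow_lt_one_of_one_lt_of_neg one_lt_two (by linarith)
  -- The covering sets may leave [0,1], outside which there are no dyadic intervals, so they are cut
  -- down to E.
  have hae : ∀ᵐ ω ∂P, ∀ n,
      packingPremeasure s (cascadeFun (fun k => X k ω) '' (A n ∩ E)) < ∞ :=
    ae_all_iff.2 fun n => ae_packingPremeasure_image_lt_top hX hs
      (hmom s (Ioc_subset_Icc_self hs)) (inter_subset_right.trans hE)
      ((packingPremeasure_mono _ inter_subset_left).trans_lt (hfin n)) hκ
  filter_upwards [hae, hWX] with ω hω hω'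
  rw [funext hω']
  refine packingDim_le_of_cover hs.1.le _ ?_ hω
  rw [← image_iUnion, ← iUnion_inter]
  exact image_mono (subset_inter hA subset_rfl)

/-- At s itself the moment sum is only critical. The strict inequality holds at exponents above s,
and a sequence decreasing to s involves only countably many null sets. -/
theorem ae_packingDim_image_le (hindep : iIndepFun Wt P) {E : Set ℝ} (hE : E ⊆ Icc 0 1)
    {d : ℝ≥0} (hd : packingDim E = d) {s : ℝ} (hs : s ∈ Ico (0 : ℝ) 1)
    (heq : halfMoment P₀ W s = 2 ^ (-(d : ℝ))) :
    ∀ᵐ ω ∂P, packingDim (cascadeFun (fun i => Wt i ω) '' E) ≤ ENNReal.ofReal s := by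
  obtain ⟨v, -, hv, hlim⟩ := exists_seq_strictAnti_tendsto' hs.2
  have hae : ∀ᵐ ω ∂P, ∀ n,
      packingDim (cascadeFun (fun i => Wt i ω) '' E) ≤ ENNReal.ofReal (v n) := by
    refine ae_all_iff.2 fun n => ?_
    have hvn : v n ∈ Ioc (0 : ℝ) 1 := ⟨hs.1.trans_lt (hv n).1, (hv n).2.le⟩
    refine ae_packingDim_image_le_of_lt hW hdistrib hindep hE hd hvn ?_
    rw [← heq]
    exact strictAntiOn_halfMoment hW (Ico_subset_Icc_self hs) (Ioc_subset_Icc_self hvn) (hv n).1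
  filter_upwards [hae] with ω hω
  exact ge_of_tendsto' (ENNReal.tendsto_ofReal hlim) hω

end

end Cascade

end

theorem corollary1p5
    {Ω₀ : Type*} [MeasurableSpace Ω₀] (P₀ : Measure Ω₀) [IsProbabilityMeasure P₀]
    (W : Ω₀ → ℝ) (hW : Cascade.IsSubcritical P₀ W)
    {Ω : Type*} [MeasurableSpace Ω] (P : Measure Ω) [IsProbabilityMeasure P]
    (Wt : List Bool → Ω → ℝ)
    (hdistrib : ∀ i, IdentDistrib (Wt i) W P P₀)
    (hindep : iIndepFun Wt P)
    (E : Set ℝ) (hE : E ⊆ Icc 0 1) (hne : E.Nonempty) (hcompact : IsCompact E)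
    (dE : ℝ≥0) (hdE : Cascade.packingDim E = dE) :
    (∃! s : ℝ, s ∈ Icc (0 : ℝ) 1 ∧
      (2 : ℝ) ^ (dE : ℝ) = (2 : ℝ) ^ s / ∫ ω, W ω ^ s ∂P₀) ∧
    ∀ s : ℝ, (2 : ℝ) ^ (dE : ℝ) = (2 : ℝ) ^ s / ∫ ω, W ω ^ s ∂P₀ →
      ∀ᵐ ω ∂P,
        Cascade.packingDim (Cascade.cascadeFun (fun i => Wt i ω) '' E) ≤ ENNReal.ofReal s := by
  have hd1 : dE ≤ 1 := by
    have := Cascade.packingDim_le_one E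
    rw [hdE] at this
    exact_mod_cast this
  refine ⟨Cascade.existsUnique_moment_eq hW dE.2 (by exact_mod_cast hd1), fun s hs => ?_⟩
  have hs0 : 0 ≤ s := Cascade.nonneg_of_moment_eq hW dE.2 hs
  -- For s ≥ 1 the bound holds for every subset of the line.
  rcases lt_or_ge s 1 with hs1 | hs1
  · exact Cascade.ae_packingDim_image_le hW hdistrib hindep hE hdE ⟨hs0, hs1⟩
      ((Cascade.eq_div_iff_halfMoment hW).1 hs)
  · exact ae_of_all _ fun ω => (Cascade.packingDim_le_one _).trans
      (by rwa [ENNReal.one_le_ofReal])
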